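/- Let $\mathfrak h$ be a real separable Hilbert space with complexification $\mathfrak h_{\mathbb C}$ (inner products are conjugate linear in the first argument, $\overline{h_1+ih_2}=h_1-ih_2$ for $h_1,h_2\in\mathfrak h$), let $\mathfrak H=\Gamma_s(\mathfrak h_{\mathbb C})=\bigoplus_{n\ge 0}\mathfrak h_{\mathbb C}^{\odot n}$ be the symmetric Fock space, and let $\mathcal E(k)=\sum_{n\ge0}k^{\otimes n}/\sqrt{n!}$, $k\in\mathfrak h_{\mathbb C}$, be the exponential vectors. Let $a^+(h)$, $a(h)$ be the creation and annihilation operators ($a^+$ linear, $a$ conjugate linear in $h$), and put $Q(h)=a(\overline h)+a^+(h)$, $P(h)=i\big(a(\overline h)-a^+(h)\big)$. A formal expression $\sum_j X_jB_jY_j$ with $B_j\in\mathcal B(\mathfrak H)$ and with operators $X_j,Y_j$ that are defined, together with their adjoints, on the span of the exponential vectors is said to define the bounded operator $M\in\mathcal B(\mathfrak H)$ if $\langle\mathcal E(f),M\mathcal E(g)\rangle=\sum_j\langle X_j^*\mathcal E(f),B_jY_j\mathcal E(g)\rangle$ for all $f,g\in\mathfrak h_{\mathbb C}$. For $h=(h_1,h_2)\in\mathfrak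 h\otimes\mathbb R^2$ let $O_h(\varphi)$ denote the Weyl quantization: $\varphi:\mathbb R^2\to\mathbb C$ lies in $\mathrm{Dom}\,O_h$ and $O_h(\varphi)=M\in\mathcal B(\mathfrak H)$ if $$\langle\mathcal E(k_1),M\mathcal E(k_2)\rangle=\frac1{2\pi}\int\langle\mathcal E(k_1),U(xh_1,yh_2)\mathcal E(k_2)\rangle\,\mathcal F^{-1}\varphi(x,y)\,dx\,dy\qquad(k_1,k_2\in\mathfrak h_{\mathbb C}),$$ where $U(h_1,h_2)=\exp\big(iP(h_1)+iQ(h_2)\big)$ are the Weyl operators, $\mathcal F^{-1}\varphi(x,y)=\frac1{2\pi}\int\varphi(u,v)e^{-i(ux+vy)}\,du\,dv$, and the integral is understood by duality, i.e. as $\int\varphi\,dm$ for the complex measure $m$ with $\int e^{i(ux+vy)}\,dm(x,y)=\langle\mathcal E(k_1),U(uh_1,vh_2)\mathcal E(k_2)\rangle$. Let $\mathcal S\subseteq\mathcal B(\mathfrak H)$ be the algebra generated by all $O_h(\varphi)$ with $h\in\mathfrak h\otimes\mathbb R^2$ and $\varphi\in C^\infty(\mathbb R^2)$ all of whose partial derivatives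 lie in $\mathrm{Dom}\,O_h$. Let $\mathcal S_{\mathfrak h,\delta}$ be the set of all $u=\sum_{j=1}^nF_j\otimes h^{(j)}\in\mathcal B(\mathfrak H)\otimes\mathfrak h_{\mathbb C}\otimes\mathbb C^2$ with $F_j\in\mathcal S$ and $h^{(j)}=(h^{(j)}_1,h^{(j)}_2)\in\mathfrak h_{\mathbb C}\otimes\mathbb C^2$ for which $$\delta(u)=\frac12\sum_{j=1}^n\big\{P(h^{(j)}_1)+Q(h^{(j)}_2),F_j\big\}-\sum_{j=1}^nD_{h^{(j)}}F_j,\qquad D_kB=\frac i2\big[Q(k_1)-P(k_2),B\big],$$ defines a bounded operator $\delta(u)$ on $\mathfrak H$. An element $O\otimes k$ of $\mathcal B(\mathfrak H)\otimes\mathfrak h_{\mathbb C}\otimes\mathbb C^2$ acts as the operator $v\mapsto Ov\otimes k$ from $\mathfrak H$ to $\mathfrak H\otimes\mathfrak h_{\mathbb C}\otimes\mathbb C^2$. Theorem. For all $u\in\mathcal S_{\mathfrak h,\delta}$ and all $k_1,k_2\in\mathfrak h_{\mathbb C}$, $$\langle\mathcal E(k_1),\delta(u)\mathcal E(k_2)\rangle=\left\langle\mathcal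 E(k_1)\otimes\begin{pmatrix}ik_1-i\overline k_2\\ k_1+\overline k_2\end{pmatrix},\;u\,\mathcal E(k_2)\right\rangle,$$ whichever representation $u=\sum_jF_j\otimes h^{(j)}$ as above is used to form $\delta(u)$. -/

import Mathlib

open scoped InnerProductSpace TensorProduct ContDiff ComplexConjugate

noncomputable section

namespace QMalliavin

open MeasureTheory UniformSpace

universe u

/-! ### The complexification of a real Hilbert space -/

/-- The complexification `𝔥_ℂ` of a real Hilbert space `𝔥`; the element `⟨a, b⟩` is `a + i b`. -/
@[ext]
structure Complexification (𝔥 : Type u) : Type u where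
  re : 𝔥
  im : 𝔥

namespace Complexification

variable {𝔥 : Type u} [NormedAddCommGroup 𝔥]

instance : Zero (Complexification 𝔥) := ⟨⟨0, 0⟩⟩
instance : Add (Complexification 𝔥) := ⟨fun x y => ⟨x.re + y.re, x.im + y.im⟩⟩
instance : Neg (Complexification 𝔥) := ⟨fun x => ⟨-x.re, -x.im⟩⟩
@[simp] theorem zero_re : (0 : Complexification 𝔥).re = 0 := rfl
@[simp] theorem zero_im : (0 : Complexification 𝔥).im = 0 := rfl
@[simp] theorem add_re (x y : Complexification 𝔥) : (x + y).re = x.re + y.re := rfl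
@[simp] theorem add_im (x y : Complexification 𝔥) : (x + y).im = x.im + y.im := rfl
@[simp] theorem neg_re (x : Complexification 𝔥) : (-x).re = -x.re := rfl
@[simp] theorem neg_im (x : Complexification 𝔥) : (-x).im = -x.im := rfl
variable [InnerProductSpace ℝ 𝔥]

instance : SMul ℂ (Complexification 𝔥) :=
  ⟨fun c x => ⟨c.re • x.re - c.im • x.im, c.re • x.im + c.im • x.re⟩⟩

@[simp] theorem smul_re (c : ℂ) (x : Complexification 𝔥) :
    (c • x).re = c.re • x.re - c.im • x.im := rfl
@[simp] theorem smul_im (c : ℂ) (x : Complexification 𝔥) :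
    (c • x).im = c.re • x.im + c.im • x.re := rfl

instance : AddCommGroup (Complexification 𝔥) where
  add_assoc x y z := by ext <;> simp [add_assoc]
  zero_add x := by ext <;> simp
  add_zero x := by ext <;> simp
  add_comm x y := by ext <;> simp [add_comm]
  neg_add_cancel x := by ext <;> simp
  nsmul := nsmulRec
  zsmul := zsmulRec

instance : Module ℂ (Complexification 𝔥) where
  one_smul x := by ext <;> simp
  mul_smul a b x := by
    ext <;> simp only [smul_re, smul_im, Complex.mul_re, Complex.mul_im] <;> module
  smul_zero a := by ext <;> simp
  smul_add a x y := by ext <;> simp only [smul_re, smul_im, add_re, add_im] <;> module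
  add_smul a b x := by
    ext <;> simp only [smul_re, smul_im, add_re, add_im, Complex.add_re, Complex.add_im] <;> module
  zero_smul x := by ext <;> simp

/-- The sesquilinear extension of the inner product of `𝔥`, conjugate linear on the left. -/
@[reducible]
def core : InnerProductSpace.Core ℂ (Complexification 𝔥) where
  inner x y := ⟨⟪x.re, y.re⟫_ℝ + ⟪x.im, y.im⟫_ℝ, ⟪x.re, y.im⟫_ℝ - ⟪x.im, y.re⟫_ℝ⟩
  conj_inner_symm x y := by
    apply Complex.ext
    · simp [real_inner_comm]
    · simp [real_inner_comm]
  re_inner_nonneg x := by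
    have h1 := real_inner_self_nonneg (x := x.re)
    have h2 := real_inner_self_nonneg (x := x.im)
    simpa using add_nonneg h1 h2
  add_left x y z := by
    apply Complex.ext
    · simp [inner_add_left]; ring
    · simp [inner_add_left]; ring
  smul_left x y r := by
    apply Complex.ext
    · simp [inner_add_left, inner_sub_left, inner_smul_left]; ring
    · simp [inner_add_left, inner_sub_left, inner_smul_left]; ring
  definite x hx := by
    have h1 := real_inner_self_nonneg (x := x.re)
    have h2 := real_inner_self_nonneg (x := x.im)
    have h : ⟪x.re, x.re⟫_ℝ + ⟪x.im, x.im⟫_ℝ = 0 := congrArg Complex.re hx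
    ext
    · exact inner_self_eq_zero.mp (by linarith : ⟪x.re, x.re⟫_ℝ = 0)
    · exact inner_self_eq_zero.mp (by linarith : ⟪x.im, x.im⟫_ℝ = 0)

instance : NormedAddCommGroup (Complexification 𝔥) :=
  @InnerProductSpace.Core.toNormedAddCommGroup ℂ (Complexification 𝔥) _ _ _ core

instance : InnerProductSpace ℂ (Complexification 𝔥) := InnerProductSpace.ofCore core.toCore

/-- The conjugation `a + i b ↦ a - i b`. -/
def bar (x : Complexification 𝔥) : Complexification 𝔥 := ⟨x.re, -x.im⟩

/-- The embedding `𝔥 ⊆ 𝔥_ℂ` onto the real elements. -/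
def ofReal (x : 𝔥) : Complexification 𝔥 := ⟨x, 0⟩

end Complexification

open Complexification

/-! ### The symmetric Fock space -/

/-- A complex inner product space, bundled. -/
structure InnerSpace : Type (u + 1) where
  carrier : Type u
  [normed : NormedAddCommGroup carrier]
  [inner : InnerProductSpace ℂ carrier]

attribute [instance] InnerSpace.normed InnerSpace.inner

section Fock

variable (E : Type u) [NormedAddCommGroup E] [InnerProductSpace ℂ E]

/-- The algebraic tensor powers `ℂ, E ⊗ ℂ, E ⊗ (E ⊗ ℂ), …`, with the inner product
`⟪x₁ ⊗ ⋯ ⊗ xₙ, y₁ ⊗ ⋯ ⊗ yₙ⟫ = ∏ ⟪xᵢ, yᵢ⟫`. -/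
def tensorPow : ℕ → InnerSpace.{u}
  | 0 => ⟨EuclideanSpace ℂ PUnit.{u + 1}⟩
  | n + 1 => ⟨E ⊗[ℂ] (tensorPow n).carrier⟩

/-- The `n`-th algebraic tensor power of `E`. -/
abbrev TensorPow (n : ℕ) : Type u := (tensorPow E n).carrier

/-- The completions of the algebraic tensor powers. -/
def hilbertTensorPow (n : ℕ) : InnerSpace.{u} := ⟨Completion (TensorPow E n)⟩

/-- The `n`-th Hilbert space tensor power of `E`. -/
abbrev HTensorPow (n : ℕ) : Type u := (hilbertTensorPow E n).carrier

instance (n : ℕ) : CompleteSpace (HTensorPow E n) :=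
  inferInstanceAs (CompleteSpace (Completion (TensorPow E n)))

/-- The embedding of the algebraic into the Hilbert space tensor power. -/
def toHilbert (n : ℕ) : TensorPow E n →ₗᵢ[ℂ] HTensorPow E n :=
  (Completion.toComplₗᵢ : TensorPow E n →ₗᵢ[ℂ] Completion (TensorPow E n))

variable {E}

theorem denseRange_toHilbert (n : ℕ) : DenseRange (toHilbert E n) :=
  Completion.denseRange_coe (α := TensorPow E n)

/-- The tensor `h ⊗ y` of `h ∈ E` and `y ∈ E^{⊗n}`, as an element of `E^{⊗(n+1)}`. -/
def tmulPow (h : E) {n : ℕ} (y : TensorPow E n) : TensorPow E (n + 1) :=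
  (h ⊗ₜ[ℂ] y : E ⊗[ℂ] TensorPow E n)

theorem inner_tmulPow (h k : E) {n : ℕ} (y z : TensorPow E n) :
    inner ℂ (tmulPow h y) (tmulPow k z) = inner ℂ h k * inner ℂ y z :=
  TensorProduct.inner_tmul ℂ h k y z

theorem norm_tmulPow (h : E) {n : ℕ} (y : TensorPow E n) : ‖tmulPow h y‖ = ‖h‖ * ‖y‖ :=
  TensorProduct.norm_tmul h y

/-- The elementary tensor `x₁ ⊗ ⋯ ⊗ xₙ`. -/
def pureTensor : {n : ℕ} → (Fin n → E) → TensorPow E n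
  | 0, _ => (EuclideanSpace.single PUnit.unit (1 : ℂ) : EuclideanSpace ℂ PUnit.{u + 1})
  | _ + 1, x => tmulPow (x 0) (pureTensor (Fin.tail x))

/-- The operator `y ↦ h ⊗ y`. -/
def tensorLeft (h : E) (n : ℕ) : HTensorPow E n →L[ℂ] HTensorPow E (n + 1) :=
  ((TensorProduct.mkL ℂ E (TensorPow E n) h).completion :
    Completion (TensorPow E n) →L[ℂ] Completion (E ⊗[ℂ] TensorPow E n))

theorem tensorLeft_toHilbert (h : E) (n : ℕ) (y : TensorPow E n) :
    tensorLeft h n (toHilbert E n y) = toHilbert E (n + 1) (tmulPow h y) :=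
  ContinuousLinearMap.completion_apply_coe (TensorProduct.mkL ℂ E (TensorPow E n) h) y

variable (E) in
/-- The `n`-th symmetric Hilbert space tensor power `E^{⊙n}`: the closed linear span of the
symmetrized elementary tensors `∑_σ x_{σ(1)} ⊗ ⋯ ⊗ x_{σ(n)}`. -/
def symPow (n : ℕ) : Submodule ℂ (HTensorPow E n) :=
  (Submodule.span ℂ (Set.range fun x : Fin n → E =>
    ∑ σ : Equiv.Perm (Fin n), toHilbert E n (pureTensor (x ∘ σ)))).topologicalClosure

instance (n : ℕ) : CompleteSpace (symPow E n) :=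
  (Submodule.isClosed_topologicalClosure _).completeSpace_coe

variable (E) in
/-- The symmetric Fock space over `E`: the Hilbert space direct sum of the `E^{⊙n}`, `n ≥ 0`. -/
abbrev SymFock : Type u := lp (fun n : ℕ => symPow E n) 2

theorem inner_pureTensor {n : ℕ} (x y : Fin n → E) :
    inner ℂ (pureTensor x) (pureTensor y) = ∏ i, inner ℂ (x i) (y i) := by
  induction n with
  | zero =>
    change inner ℂ (EuclideanSpace.single PUnit.unit (1 : ℂ) : EuclideanSpace ℂ PUnit.{u + 1})
      (EuclideanSpace.single PUnit.unit (1 : ℂ)) = _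
    simp
  | succ n ih =>
    rw [pureTensor, pureTensor, inner_tmulPow, ih, Fin.prod_univ_succ]
    rfl

theorem const_mem_symPow (n : ℕ) (k : E) :
    toHilbert E n (pureTensor fun _ : Fin n => k) ∈ symPow E n := by
  have h1 : ∑ σ : Equiv.Perm (Fin n), toHilbert E n (pureTensor ((fun _ : Fin n => k) ∘ σ)) ∈
      symPow E n :=
    Submodule.le_topologicalClosure _ (Submodule.subset_span ⟨fun _ => k, rfl⟩)
  have h2 : ∑ σ : Equiv.Perm (Fin n), toHilbert E n (pureTensor ((fun _ : Fin n => k) ∘ σ)) =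
      (n.factorial : ℂ) • toHilbert E n (pureTensor (fun _ : Fin n => k)) := by
    have : ∀ σ : Equiv.Perm (Fin n), (fun _ : Fin n => k) ∘ σ = fun _ => k := fun _ => rfl
    simp [this, Fintype.card_perm, ← Nat.cast_smul_eq_nsmul ℂ]
  rw [h2] at h1
  have h3 := (symPow E n).smul_mem ((n.factorial : ℂ)⁻¹) h1
  rwa [smul_smul, inv_mul_cancel₀ (by exact_mod_cast n.factorial_ne_zero), one_smul] at h3

/-- The vector `k^{⊗n}` of `E^{⊙n}`. -/
def powTensor (k : E) (n : ℕ) : symPow E n := ⟨_, const_mem_symPow n k⟩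

theorem inner_powTensor (k l : E) (n : ℕ) :
    inner ℂ (powTensor k n) (powTensor l n) = inner ℂ k l ^ n := by
  rw [Submodule.coe_inner, powTensor, powTensor, LinearIsometry.inner_map_map, inner_pureTensor]
  simp

theorem norm_powTensor (k : E) (n : ℕ) : ‖powTensor k n‖ = ‖k‖ ^ n := by
  have h := inner_powTensor k k n
  rw [inner_self_eq_norm_sq_to_K, inner_self_eq_norm_sq_to_K] at h
  have h' : ‖powTensor k n‖ ^ 2 = (‖k‖ ^ n) ^ 2 := by
    rw [← pow_mul, mul_comm n 2, pow_mul]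
    exact_mod_cast h
  exact (pow_left_inj₀ (norm_nonneg _) (by positivity) two_ne_zero).mp h'

/-- The component `k^{⊗n} / √n!` of the exponential vector. -/
def expComp (k : E) (n : ℕ) : symPow E n := ((√(n.factorial : ℝ) : ℝ) : ℂ)⁻¹ • powTensor k n

theorem norm_expComp_sq (k : E) (n : ℕ) :
    ‖expComp k n‖ ^ 2 = (‖k‖ ^ 2) ^ n / n.factorial := by
  rw [expComp, norm_smul, norm_powTensor, mul_pow, norm_inv, inv_pow, Complex.norm_real,
    Real.norm_eq_abs, sq_abs, Real.sq_sqrt (by positivity), ← pow_mul, ← pow_mul, mul_comm n 2]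
  field_simp

theorem memℓp_two {f : ∀ n, symPow E n} (h : Summable fun n => ‖f n‖ ^ 2) : Memℓp f 2 := by
  apply memℓp_gen
  simpa using h

/-- The exponential vector `𝓔(k) = ∑ₙ k^{⊗n} / √n!`. -/
def expVec (k : E) : SymFock E :=
  ⟨expComp k, memℓp_two (by
    simp only [norm_expComp_sq]
    exact Real.summable_pow_div_factorial _)⟩

/-! ### Creation and annihilation operators -/

/-- The bounded operator `y ↦ √(n+1) • Sym(h ⊗ y)` from `E^{⊙n}` to `E^{⊙(n+1)}`, where `Sym` is the
orthogonal projection onto the symmetric tensors. -/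
def creationComp (h : E) (n : ℕ) : symPow E n →L[ℂ] symPow E (n + 1) :=
  ((√((n : ℝ) + 1) : ℝ) : ℂ) • ((symPow E (n + 1)).orthogonalProjectionOnto ∘L
    tensorLeft h n ∘L (symPow E n).subtypeL)

/-- `x ↦ (0, a⁺(h) x₀, a⁺(h) x₁, …)`, without regard to square summability. -/
def creationSeq (h : E) : SymFock E →ₗ[ℂ] PreLp (fun n : ℕ => symPow E n) where
  toFun x := fun n => match n with
    | 0 => 0
    | n + 1 => creationComp h n (x n)
  map_add' x y := by
    funext n
    cases n with
    | zero => exact (add_zero (0 : symPow E 0)).symm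
    | succ n => exact map_add (creationComp h n) (x n) (y n)
  map_smul' c x := by
    funext n
    cases n with
    | zero => exact (smul_zero (A := symPow E 0) c).symm
    | succ n => exact map_smul (creationComp h n) c (x n)

/-- The sequence with `n`-th entry `(a⁺(h) : E^{⊙n} → E^{⊙(n+1)})^* x_{n+1}`, without regard to
square summability. -/
def annihilationSeq (h : E) : SymFock E →ₗ[ℂ] PreLp (fun n : ℕ => symPow E n) where
  toFun x := fun n => ContinuousLinearMap.adjoint (creationComp h n) (x (n + 1))
  map_add' x y := by
    funext n
    exact map_add (ContinuousLinearMap.adjoint (creationComp h n)) (x (n + 1)) (y (n + 1))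
  map_smul' c x := by
    funext n
    exact map_smul (ContinuousLinearMap.adjoint (creationComp h n)) c (x (n + 1))

/-- The operator `x ↦ L x` on the domain of all `x` for which the sequence `L x` is square
summable. -/
def maximalOp (L : SymFock E →ₗ[ℂ] PreLp (fun n : ℕ => symPow E n)) :
    SymFock E →ₗ.[ℂ] SymFock E where
  domain := (lpSubmodule ℂ (fun n : ℕ => symPow E n) 2).comap L
  toFun :=
    { toFun := fun x => ⟨L (x : SymFock E), x.2⟩
      map_add' := fun x y => Subtype.ext (map_add L (x : SymFock E) y)
      map_smul' := fun c x => Subtype.ext (map_smul L c (x : SymFock E)) }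

/-- The creation operator `a⁺(h)`, linear in `h`, on its maximal domain. -/
def creation (h : E) : SymFock E →ₗ.[ℂ] SymFock E := maximalOp (creationSeq h)

/-- The annihilation operator `a(h)`, conjugate linear in `h`, on its maximal domain. -/
def annihilation (h : E) : SymFock E →ₗ.[ℂ] SymFock E := maximalOp (annihilationSeq h)

theorem inner_tensorLeft (h k : E) (n : ℕ) (z : HTensorPow E n) :
    inner ℂ (tensorLeft h n z) (powTensor k (n + 1) : HTensorPow E (n + 1)) =
      inner ℂ h k * inner ℂ z (powTensor k n : HTensorPow E n) := by
  induction z using (denseRange_toHilbert (E := E) n).induction_on with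
  | hp =>
    exact isClosed_eq (((tensorLeft h n).continuous).inner continuous_const)
      (continuous_const.mul (continuous_id.inner continuous_const))
  | ih z =>
    rw [tensorLeft_toHilbert, powTensor, powTensor, LinearIsometry.inner_map_map,
      LinearIsometry.inner_map_map]
    exact inner_tmulPow h k z _

theorem inner_creationComp (h k : E) (n : ℕ) (y : symPow E n) :
    inner ℂ (creationComp h n y) (expComp k (n + 1)) =
      inner ℂ h k * inner ℂ y (expComp k n) := by
  have hP : inner ℂ (creationComp h n y) (powTensor k (n + 1)) =
      ((√((n : ℝ) + 1) : ℝ) : ℂ) * (inner ℂ h k * inner ℂ y (powTensor k n)) := by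
    have e1 : creationComp h n y = ((√((n : ℝ) + 1) : ℝ) : ℂ) •
        (symPow E (n + 1)).orthogonalProjectionOnto (tensorLeft h n (y : HTensorPow E n)) := rfl
    rw [e1, inner_smul_left, Complex.conj_ofReal,
      Submodule.inner_orthogonalProjectionOnto_eq_of_mem_right, inner_tensorLeft]
    rfl
  rw [expComp, inner_smul_right, hP, expComp, inner_smul_right, Nat.factorial_succ]
  have hs : (√(((n + 1) * n.factorial : ℕ) : ℝ)) = √((n : ℝ) + 1) * √(n.factorial : ℝ) := by
    push_cast
    rw [Real.sqrt_mul (by positivity)]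
  rw [hs]
  have h1 : ((√((n : ℝ) + 1) : ℝ) : ℂ) ≠ 0 := by
    have : 0 < √((n : ℝ) + 1) := Real.sqrt_pos.mpr (by positivity)
    exact_mod_cast this.ne'
  have h2 : ((√(n.factorial : ℝ) : ℝ) : ℂ) ≠ 0 := by
    have : 0 < √(n.factorial : ℝ) := Real.sqrt_pos.mpr (by positivity)
    exact_mod_cast this.ne'
  push_cast
  field_simp

theorem adjoint_creationComp_expComp (h k : E) (n : ℕ) :
    ContinuousLinearMap.adjoint (creationComp h n) (expComp k (n + 1)) =
      inner ℂ h k • expComp k n := by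
  refine ext_inner_left ℂ fun y => ?_
  rw [ContinuousLinearMap.adjoint_inner_right, inner_creationComp, inner_smul_right]

theorem annihilationSeq_expVec (h k : E) :
    annihilationSeq h (expVec k) = inner ℂ h k • ((expVec k : SymFock E) : ∀ n, symPow E n) := by
  funext n
  exact adjoint_creationComp_expComp h k n

theorem expVec_mem_annihilation (h k : E) : expVec k ∈ (annihilation h).domain := by
  change Memℓp (annihilationSeq h (expVec k)) 2
  rw [annihilationSeq_expVec]
  exact lp.memℓp (inner ℂ h k • expVec k)

theorem norm_creationComp_le (h : E) (n : ℕ) (y : symPow E n) :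
    ‖creationComp h n y‖ ^ 2 ≤ (n + 1) * ‖h‖ ^ 2 * ‖y‖ ^ 2 := by
  have hT : ∀ z : HTensorPow E n, ‖tensorLeft h n z‖ ≤ ‖h‖ * ‖z‖ := by
    intro z
    induction z using (denseRange_toHilbert (E := E) n).induction_on with
    | hp =>
      exact isClosed_le ((tensorLeft h n).continuous.norm) (continuous_const.mul continuous_norm)
    | ih z =>
      rw [tensorLeft_toHilbert, LinearIsometry.norm_map, LinearIsometry.norm_map, norm_tmulPow]
  have e1 : creationComp h n y = ((√((n : ℝ) + 1) : ℝ) : ℂ) •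
      (symPow E (n + 1)).orthogonalProjectionOnto (tensorLeft h n (y : HTensorPow E n)) := rfl
  have h1 : ‖(symPow E (n + 1)).orthogonalProjectionOnto (tensorLeft h n (y : HTensorPow E n))‖ ≤
      ‖h‖ * ‖y‖ :=
    (Submodule.norm_orthogonalProjectionOnto_apply_le _ _).trans (hT _)
  rw [e1, norm_smul, mul_pow, Complex.norm_real, Real.norm_eq_abs, sq_abs,
    Real.sq_sqrt (by positivity), mul_assoc, ← mul_pow]
  gcongr

theorem expVec_mem_creation (h k : E) : expVec k ∈ (creation h).domain := by
  change Memℓp (creationSeq h (expVec k)) 2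
  apply memℓp_two
  rw [← summable_nat_add_iff 1]
  have hb : Summable fun n : ℕ => 2 * (‖h‖ ^ 2 * ((2 * ‖k‖ ^ 2) ^ n / n.factorial)) :=
    ((Real.summable_pow_div_factorial (2 * ‖k‖ ^ 2)).mul_left _).mul_left _
  refine hb.of_nonneg_of_le (fun n => by positivity) fun n => ?_
  have h1 := norm_creationComp_le h n (expComp k n)
  have h2 : ((n : ℝ) + 1) ≤ 2 * 2 ^ n := by
    have : n + 1 ≤ 2 * 2 ^ n := by
      have := Nat.lt_two_pow_self (n := n)
      omega
    exact_mod_cast this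
  calc ‖creationComp h n (expComp k n)‖ ^ 2
      ≤ (n + 1) * ‖h‖ ^ 2 * ‖expComp k n‖ ^ 2 := h1
    _ = (n + 1) * (‖h‖ ^ 2 * ((‖k‖ ^ 2) ^ n / n.factorial)) := by rw [norm_expComp_sq]; ring
    _ ≤ (2 * 2 ^ n) * (‖h‖ ^ 2 * ((‖k‖ ^ 2) ^ n / n.factorial)) := by gcongr
    _ = 2 * (‖h‖ ^ 2 * ((2 * ‖k‖ ^ 2) ^ n / n.factorial)) := by rw [mul_pow 2 (‖k‖ ^ 2) n]; ring

/-! ### Operators on the exponential vectors -/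

variable (E) in
/-- The linear span of the exponential vectors. -/
def expSpan : Submodule ℂ (SymFock E) := Submodule.span ℂ (Set.range expVec)

/-- The exponential vector, as an element of the span. -/
def expVec' (k : E) : expSpan E := ⟨expVec k, Submodule.subset_span ⟨k, rfl⟩⟩

variable (E) in
/-- The space `𝓛(𝓔(E), 𝓗)`: linear operators `B` from the span of the exponential vectors to the
Fock space, together with an operator `B^*` of the same kind such that
`⟪𝓔(f), B 𝓔(g)⟫ = ⟪B^* 𝓔(f), 𝓔(g)⟫`. -/
structure ExpOp where
  op : expSpan E →ₗ[ℂ] SymFock E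
  adj : expSpan E →ₗ[ℂ] SymFock E
  inner_adj : ∀ f g : E, inner ℂ (expVec f) (op (expVec' g)) = inner ℂ (adj (expVec' f)) (expVec g)

namespace ExpOp

instance : Add (ExpOp E) :=
  ⟨fun X Y => ⟨X.op + Y.op, X.adj + Y.adj, fun f g => by
    rw [LinearMap.add_apply, LinearMap.add_apply, inner_add_left, inner_add_right, X.inner_adj,
      Y.inner_adj]⟩⟩

instance : Sub (ExpOp E) :=
  ⟨fun X Y => ⟨X.op - Y.op, X.adj - Y.adj, fun f g => by
    rw [LinearMap.sub_apply, LinearMap.sub_apply, inner_sub_left, inner_sub_right, X.inner_adj,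
      Y.inner_adj]⟩⟩

instance : SMul ℂ (ExpOp E) :=
  ⟨fun c X => ⟨c • X.op, conj c • X.adj, fun f g => by
    rw [LinearMap.smul_apply, LinearMap.smul_apply, inner_smul_left, inner_smul_right,
      X.inner_adj, Complex.conj_conj]⟩⟩

end ExpOp

theorem expSpan_le {T : SymFock E →ₗ.[ℂ] SymFock E} (h : ∀ k, expVec k ∈ T.domain) :
    expSpan E ≤ T.domain :=
  Submodule.span_le.mpr (by rintro _ ⟨k, rfl⟩; exact h k)

/-- The restriction of an unbounded operator to the span of the exponential vectors. -/
def restrictExp (T : SymFock E →ₗ.[ℂ] SymFock E) (h : ∀ k, expVec k ∈ T.domain) :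
    expSpan E →ₗ[ℂ] SymFock E :=
  T.toFun ∘ₗ Submodule.inclusion (expSpan_le h)

theorem inner_annihilation_expVec (h f g : E) :
    inner ℂ (expVec f) (restrictExp (annihilation h) (expVec_mem_annihilation h) (expVec' g)) =
      inner ℂ (restrictExp (creation h) (expVec_mem_creation h) (expVec' f)) (expVec g) := by
  set x := restrictExp (annihilation h) (expVec_mem_annihilation h) (expVec' g)
  set y := restrictExp (creation h) (expVec_mem_creation h) (expVec' f)
  have hy := lp.hasSum_inner (𝕜 := ℂ) y (expVec g)
  have hx := lp.hasSum_inner (𝕜 := ℂ) (expVec f) x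
  rw [← hasSum_nat_add_iff' 1] at hy
  have h0 : ∑ i ∈ Finset.range 1, inner ℂ (y i) (expVec g i) = 0 := by
    rw [Finset.sum_range_one]
    exact inner_zero_left _
  rw [h0, sub_zero] at hy
  have h1 : ∀ n, inner ℂ (expVec f n) (x n) = inner ℂ (y (n + 1)) (expVec g (n + 1)) := fun n =>
    ContinuousLinearMap.adjoint_inner_right (creationComp h n) (expComp f n) (expComp g (n + 1))
  simp only [h1] at hx
  exact hx.unique hy

/-- The annihilation operator on the exponential vectors, with adjoint `a⁺(h)`. -/
def annihilationExp (h : E) : ExpOp E where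
  op := restrictExp (annihilation h) (expVec_mem_annihilation h)
  adj := restrictExp (creation h) (expVec_mem_creation h)
  inner_adj := inner_annihilation_expVec h

/-- The creation operator on the exponential vectors, with adjoint `a(h)`. -/
def creationExp (h : E) : ExpOp E where
  op := restrictExp (creation h) (expVec_mem_creation h)
  adj := restrictExp (annihilation h) (expVec_mem_annihilation h)
  inner_adj f g := by
    rw [← inner_conj_symm, ← inner_annihilation_expVec, inner_conj_symm]

/-- The matrix element `⟪X^* 𝓔(f), B 𝓔(g)⟫` of the formal product `X B`. -/
def ExpOp.mulBounded (X : ExpOp E) (B : SymFock E →L[ℂ] SymFock E) (f g : E) : ℂ :=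
  inner ℂ (X.adj (expVec' f)) (B (expVec g))

/-- The matrix element `⟪𝓔(f), B X 𝓔(g)⟫` of the formal product `B X`. -/
def ExpOp.boundedMul (B : SymFock E →L[ℂ] SymFock E) (X : ExpOp E) (f g : E) : ℂ :=
  inner ℂ (expVec f) (B (X.op (expVec' g)))

/-- The matrix element of the formal anti-commutator `{X, B} = X B + B X`. -/
def ExpOp.anticomm (X : ExpOp E) (B : SymFock E →L[ℂ] SymFock E) (f g : E) : ℂ :=
  X.mulBounded B f g + ExpOp.boundedMul B X f g

/-- The matrix element of the formal commutator `[X, B] = X B - B X`. -/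
def ExpOp.comm (X : ExpOp E) (B : SymFock E →L[ℂ] SymFock E) (f g : E) : ℂ :=
  X.mulBounded B f g - ExpOp.boundedMul B X f g

/-- A formal expression, given by its matrix elements `b(f, g)` between `𝓔(f)` and `𝓔(g)`, defines
the bounded operator `M`. -/
def DefinesBounded (b : E → E → ℂ) (M : SymFock E →L[ℂ] SymFock E) : Prop :=
  ∀ f g : E, inner ℂ (expVec f) (M (expVec g)) = b f g

end Fock

/-! ### Hilbert space tensor products -/

section HilbertTensor

variable (H K : Type u) [NormedAddCommGroup H] [InnerProductSpace ℂ H]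
  [NormedAddCommGroup K] [InnerProductSpace ℂ K]

/-- The completion of the algebraic tensor product `H ⊗ K`. -/
def hilbertTensor : InnerSpace.{u} := ⟨Completion (H ⊗[ℂ] K)⟩

/-- The Hilbert space tensor product of `H` and `K`. -/
abbrev HTensor : Type u := (hilbertTensor H K).carrier

instance : CompleteSpace (HTensor H K) := inferInstanceAs (CompleteSpace (Completion (H ⊗[ℂ] K)))

/-- The embedding of the algebraic into the Hilbert space tensor product. -/
def toHTensor : H ⊗[ℂ] K →ₗᵢ[ℂ] HTensor H K :=
  (Completion.toComplₗᵢ : H ⊗[ℂ] K →ₗᵢ[ℂ] Completion (H ⊗[ℂ] K))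

variable {H K}

/-- The vector `x ⊗ y` of the Hilbert space tensor product. -/
def htmul (x : H) (y : K) : HTensor H K := toHTensor H K (x ⊗ₜ[ℂ] y)

theorem inner_htmul (x x' : H) (y y' : K) :
    inner ℂ (htmul x y) (htmul x' y') = inner ℂ x x' * inner ℂ y y' := by
  rw [htmul, htmul, LinearIsometry.inner_map_map, TensorProduct.inner_tmul]

/-- The bounded operator `v ↦ v ⊗ k`. -/
def tensorRight (k : K) : H →L[ℂ] HTensor H K :=
  (toHTensor H K).toContinuousLinearMap ∘L (TensorProduct.mkL ℂ H K).flip k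

theorem tensorRight_apply (k : K) (v : H) : tensorRight k v = htmul v k := rfl

/-- The linear map from `𝓑(H) ⊗ K` to `𝓑(H, H ⊗ K)` that maps `O ⊗ k` to the operator
`v ↦ O v ⊗ k`. -/
def toModule : (H →L[ℂ] H) ⊗[ℂ] K →ₗ[ℂ] (H →L[ℂ] HTensor H K) :=
  TensorProduct.lift (LinearMap.mk₂ ℂ (fun O k => tensorRight k ∘L O)
    (fun O O' k => by ext1 v; simp)
    (fun c O k => by ext1 v; simp)
    (fun O k k' => by ext1 v; simp [tensorRight])
    (fun c O k => by ext1 v; simp [tensorRight]))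

theorem toModule_tmul_apply (O : H →L[ℂ] H) (k : K) (v : H) :
    toModule (O ⊗ₜ[ℂ] k) v = htmul (O v) k := rfl

end HilbertTensor

/-! ### The non-commutative Wiener space over a real Hilbert space -/

section Wiener

variable (𝔥 : Type u) [NormedAddCommGroup 𝔥] [InnerProductSpace ℝ 𝔥]

/-- The symmetric Fock space `𝓗 = Γ_s(𝔥_ℂ)`. -/
abbrev Fock : Type u := SymFock (Complexification 𝔥)

/-- The algebra `𝓑(𝓗)`. -/
abbrev BFock : Type u := Fock 𝔥 →L[ℂ] Fock 𝔥

/-- The Hilbert space `𝔥_ℂ ⊗ ℂ²`, as the space of pairs `(h₁, h₂)`. -/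
abbrev Dir : Type u := WithLp 2 (Complexification 𝔥 × Complexification 𝔥)

variable {𝔥}

/-- The position operator `Q(h) = a(h̄) + a⁺(h)`. -/
def position (h : Complexification 𝔥) : ExpOp (Complexification 𝔥) :=
  annihilationExp h.bar + creationExp h

/-- The momentum operator `P(h) = i (a(h̄) - a⁺(h))`. -/
def momentum (h : Complexification 𝔥) : ExpOp (Complexification 𝔥) :=
  Complex.I • (annihilationExp h.bar - creationExp h)

/-- The vector `U(h₁, h₂) 𝓔(f)` for the Weyl operator `U(h₁, h₂) = exp(i P(h₁) + i Q(h₂))` with real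
`h₁, h₂`: with `z = h₁ + i h₂`, it is `exp(-⟪z, f⟫ - ‖z‖² / 2) 𝓔(f + z)`. -/
def weyl (h₁ h₂ : 𝔥) (f : Complexification 𝔥) : Fock 𝔥 :=
  Complex.exp (-inner ℂ (⟨h₁, h₂⟩ : Complexification 𝔥) f - ((‖h₁‖ : ℂ) ^ 2 + (‖h₂‖ : ℂ) ^ 2) / 2) •
    expVec (f + ⟨h₁, h₂⟩)

/-- `IsWeylQuantization h₁ h₂ φ M` says that `φ ∈ Dom O_h` and `O_h(φ) = M` for `h = (h₁, h₂)`, i.e.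
`⟪𝓔(k₁), M 𝓔(k₂)⟫ = (2π)⁻¹ ∫ ⟪𝓔(k₁), U(u h₁, v h₂) 𝓔(k₂)⟫ (𝓕⁻¹φ)(u, v) du dv` for all `k₁, k₂`.
Here `𝓕⁻¹φ` is in general a distribution (a Dirac measure for exponential functions), and the
integral is the duality pairing: if `⟪𝓔(k₁), U(u h₁, v h₂) 𝓔(k₂)⟫ = ∫ exp(i (u x + v y)) m(dx, dy)`
for the complex measure `m = ρ μ`, it is `∫ φ dm`. -/
def IsWeylQuantization (h₁ h₂ : 𝔥) (φ : ℝ × ℝ → ℂ) (M : BFock 𝔥) : Prop :=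
  ∀ k₁ k₂ : Complexification 𝔥, ∃ (μ : Measure (ℝ × ℝ)) (ρ : ℝ × ℝ → ℂ),
    IsFiniteMeasure μ ∧ Integrable ρ μ ∧
    (∀ u v : ℝ, inner ℂ (expVec k₁) (weyl (u • h₁) (v • h₂) k₂) =
      ∫ p, Complex.exp (Complex.I * ((u * p.1 + v * p.2 : ℝ) : ℂ)) * ρ p ∂μ) ∧
    Integrable (fun p => φ p * ρ p) μ ∧
    inner ℂ (expVec k₁) (M (expVec k₂)) = ∫ p, φ p * ρ p ∂μ

/-- `φ ∈ Dom O_h`. -/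
def MemWeylDomain (h₁ h₂ : 𝔥) (φ : ℝ × ℝ → ℂ) : Prop := ∃ M, IsWeylQuantization h₁ h₂ φ M

/-- `∂φ/∂x`. -/
def partialX (φ : ℝ × ℝ → ℂ) : ℝ × ℝ → ℂ := fun p => fderiv ℝ φ p (1, 0)

/-- `∂φ/∂y`. -/
def partialY (φ : ℝ × ℝ → ℂ) : ℝ × ℝ → ℂ := fun p => fderiv ℝ φ p (0, 1)

variable (𝔥) in
/-- The algebra `𝓢` of smooth functionals, generated by the operators `O_h(φ)` with `h ∈ 𝔥 ⊗ ℝ²` and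
`φ` a smooth function all of whose partial derivatives are in `Dom O_h`. -/
def smoothAlg : Subalgebra ℂ (BFock 𝔥) :=
  Algebra.adjoin ℂ {M | ∃ (h₁ h₂ : 𝔥) (φ : ℝ × ℝ → ℂ), ContDiff ℝ ∞ φ ∧
    (∀ a b : ℕ, MemWeylDomain h₁ h₂ (partialX^[a] (partialY^[b] φ))) ∧
    IsWeylQuantization h₁ h₂ φ M}

/-- The matrix elements of the formal expression `D_k B = (i/2) [Q(k₁) - P(k₂), B]`. -/
def derivationForm (k : Dir 𝔥) (B : BFock 𝔥) (f g : Complexification 𝔥) : ℂ :=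
  Complex.I / 2 * (position k.fst - momentum k.snd).comm B f g

/-- The matrix elements of the formal expression
`½ ∑ⱼ {P(h₁⁽ʲ⁾) + Q(h₂⁽ʲ⁾), Fⱼ} - ∑ⱼ D_{h⁽ʲ⁾} Fⱼ`. -/
def divergenceForm {n : ℕ} (F : Fin n → BFock 𝔥) (h : Fin n → Dir 𝔥)
    (f g : Complexification 𝔥) : ℂ :=
  1 / 2 * ∑ j, (momentum (h j).fst + position (h j).snd).anticomm (F j) f g -
    ∑ j, derivationForm (h j) (F j) f g

/-- `u` is the elementary vector field `∑ⱼ Fⱼ ⊗ h⁽ʲ⁾ ∈ 𝓑(𝓗) ⊗ 𝔥_ℂ ⊗ ℂ²` with all `Fⱼ ∈ 𝓢`, for which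
the expression `½ ∑ⱼ {P(h₁⁽ʲ⁾) + Q(h₂⁽ʲ⁾), Fⱼ} - ∑ⱼ D_{h⁽ʲ⁾} Fⱼ` defines the bounded operator `M`. -/
def IsDivergence (u : BFock 𝔥 ⊗[ℂ] Dir 𝔥) (M : BFock 𝔥) : Prop :=
  ∃ (n : ℕ) (F : Fin n → BFock 𝔥) (h : Fin n → Dir 𝔥), (∀ j, F j ∈ smoothAlg 𝔥) ∧
    u = ∑ j, F j ⊗ₜ[ℂ] h j ∧ DefinesBounded (divergenceForm F h) M

variable (𝔥) in
/-- The domain `𝓢_{𝔥,δ}` of the divergence operator. -/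
def divergenceDomain : Set (BFock 𝔥 ⊗[ℂ] Dir 𝔥) := {u | ∃ M, IsDivergence u M}

/-- The divergence operator `δ : 𝓢_{𝔥,δ} → 𝓑(𝓗)`. -/
def divergence (u : divergenceDomain 𝔥) : BFock 𝔥 := u.2.choose

theorem isDivergence_divergence (u : divergenceDomain 𝔥) : IsDivergence u.1 (divergence u) :=
  u.2.choose_spec

end Wiener

end QMalliavin

end

/-!
In `δ(u) = ½ ∑ⱼ {P(h₁) + Q(h₂), Fⱼ} - ∑ⱼ (i/2) [Q(h₁) - P(h₂), Fⱼ]` collect the terms on either side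
of `Fⱼ`. To the left of `Fⱼ` the annihilation operators cancel and `a⁺(h₂ - i h₁)` remains; to the
right the creation operators cancel and `a` of the conjugate of `h₂ + i h₁` remains. Since
`a(h) 𝓔(k) = ⟪h, k⟫ 𝓔(k)` and `a⁺(h)` is adjoint to `a(h)`, every term is a scalar multiple of
`⟪𝓔(f), Fⱼ 𝓔(g)⟫`, and the scalar `⟪f, h₂ - i h₁⟫ + ⟪ḡ, h₂ + i h₁⟫` is the inner product of
`(i f - i ḡ, f + ḡ)` with `(h₁, h₂)` (`divergenceForm_term`). Summing over `j` gives the matrix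
element of `u` itself, which does not depend on how `u` is written as a sum of elementary tensors.
-/

namespace QMalliavin

section Fock

universe v

variable {E : Type v} [NormedAddCommGroup E] [InnerProductSpace ℂ E]

/-- Exponential vectors are eigenvectors of the annihilation operators. -/
theorem annihilation_apply_expVec (h k : E) :
    restrictExp (annihilation h) (expVec_mem_annihilation h) (expVec' k) =
      inner ℂ h k • expVec k :=
  Subtype.ext (annihilationSeq_expVec h k)

theorem annihilationExp_op_expVec (h k : E) :
    (annihilationExp h).op (expVec' k) = inner ℂ h k • expVec k :=
  annihilation_apply_expVec h k

theorem creationExp_adj_expVec (h k : E) :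
    (creationExp h).adj (expVec' k) = inner ℂ h k • expVec k :=
  annihilation_apply_expVec h k

end Fock

theorem Complexification.inner_bar_left {𝔥 : Type*} [NormedAddCommGroup 𝔥]
    [InnerProductSpace ℝ 𝔥] (x y : Complexification 𝔥) :
    inner ℂ x.bar y = inner ℂ y.bar x := by
  apply Complex.ext
  · change ⟪x.re, y.re⟫_ℝ + ⟪-x.im, y.im⟫_ℝ = ⟪y.re, x.re⟫_ℝ + ⟪-y.im, x.im⟫_ℝ
    simp [real_inner_comm]
  · change ⟪x.re, y.im⟫_ℝ - ⟪-x.im, y.re⟫_ℝ = ⟪y.re, x.im⟫_ℝ - ⟪-y.im, x.re⟫_ℝ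
    simp only [inner_neg_left, real_inner_comm]
    ring

section Wiener

universe v

variable {𝔥 : Type v} [NormedAddCommGroup 𝔥] [InnerProductSpace ℝ 𝔥]

/-- The contribution of a single elementary tensor `B ⊗ h` to the divergence. -/
theorem divergenceForm_term (B : BFock 𝔥) (h : Dir 𝔥) (f g : Complexification 𝔥) :
    1 / 2 * (momentum h.fst + position h.snd).anticomm B f g - derivationForm h B f g =
      inner ℂ (WithLp.toLp 2 (Complex.I • f - Complex.I • g.bar, f + g.bar) : Dir 𝔥) h *
        inner ℂ (expVec f) (B (expVec g)) := by
  have hR (x y : Complexification 𝔥) :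
      inner ℂ (WithLp.toLp 2 (x, y) : Dir 𝔥) h = inner ℂ x h.fst + inner ℂ y h.snd :=
    WithLp.prod_inner_apply _ h
  -- The definitions of the operations on `ExpOp` are unfolded so that the vectors `a(h)^* 𝓔(f)` and
  -- `a⁺(h) 𝓔(g)`, which are not multiples of exponential vectors, appear explicitly and cancel.
  change 1 / 2 *
      (inner ℂ (conj Complex.I • ((annihilationExp h.fst.bar).adj (expVec' f) -
            (creationExp h.fst).adj (expVec' f)) +
          ((annihilationExp h.snd.bar).adj (expVec' f) + (creationExp h.snd).adj (expVec' f)))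
        (B (expVec g)) +
      inner ℂ (expVec f) (B (Complex.I • ((annihilationExp h.fst.bar).op (expVec' g) -
            (creationExp h.fst).op (expVec' g)) +
          ((annihilationExp h.snd.bar).op (expVec' g) + (creationExp h.snd).op (expVec' g))))) -
    Complex.I / 2 *
      (inner ℂ (((annihilationExp h.fst.bar).adj (expVec' f) + (creationExp h.fst).adj (expVec' f)) -
          conj Complex.I • ((annihilationExp h.snd.bar).adj (expVec' f) -
            (creationExp h.snd).adj (expVec' f)))
        (B (expVec g)) -
      inner ℂ (expVec f) (B (((annihilationExp h.fst.bar).op (expVec' g) +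
            (creationExp h.fst).op (expVec' g)) -
          Complex.I • ((annihilationExp h.snd.bar).op (expVec' g) -
            (creationExp h.snd).op (expVec' g))))) = _
  simp only [annihilationExp_op_expVec, creationExp_adj_expVec, Complexification.inner_bar_left _ g,
    hR, map_add, map_sub, map_smul, inner_add_left, inner_sub_left,
    inner_add_right, inner_sub_right, inner_smul_left, inner_smul_right, inner_conj_symm,
    Complex.conj_I, map_neg, neg_neg]
  ring_nf
  simp only [Complex.I_sq]
  ring

theorem inner_eq_of_isDivergence {u : BFock 𝔥 ⊗[ℂ] Dir 𝔥} {M : BFock 𝔥} (hM : IsDivergence u M)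
    (k₁ k₂ : Complexification 𝔥) :
    inner ℂ (expVec k₁) (M (expVec k₂)) =
      inner ℂ
        (htmul (expVec k₁)
          (WithLp.toLp 2 (Complex.I • k₁ - Complex.I • k₂.bar, k₁ + k₂.bar) : Dir 𝔥))
        (toModule u (expVec k₂)) := by
  obtain ⟨n, F, h, -, rfl, hM⟩ := hM
  rw [hM, divergenceForm, Finset.mul_sum, ← Finset.sum_sub_distrib, map_sum,
    sum_apply, inner_sum]
  refine Finset.sum_congr rfl fun j _ => ?_
  rw [divergenceForm_term, toModule_tmul_apply, inner_htmul, mul_comm]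

end Wiener

end QMalliavin

theorem mainTheorem5 {𝔥 : Type*} [NormedAddCommGroup 𝔥] [InnerProductSpace ℝ 𝔥] [CompleteSpace 𝔥]
    [TopologicalSpace.SeparableSpace 𝔥] (u : QMalliavin.divergenceDomain 𝔥)
    (k₁ k₂ : QMalliavin.Complexification 𝔥) :
    inner ℂ (QMalliavin.expVec k₁) (QMalliavin.divergence u (QMalliavin.expVec k₂)) =
        inner ℂ
          (QMalliavin.htmul (QMalliavin.expVec k₁)
            (WithLp.toLp 2 (Complex.I • k₁ - Complex.I • k₂.bar, k₁ + k₂.bar)))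
          (QMalliavin.toModule u.1 (QMalliavin.expVec k₂)) ∧
      ∀ M : QMalliavin.BFock 𝔥, QMalliavin.IsDivergence u.1 M →
        inner ℂ (QMalliavin.expVec k₁) (M (QMalliavin.expVec k₂)) =
          inner ℂ
            (QMalliavin.htmul (QMalliavin.expVec k₁)
              (WithLp.toLp 2 (Complex.I • k₁ - Complex.I • k₂.bar, k₁ + k₂.bar)))
            (QMalliavin.toModule u.1 (QMalliavin.expVec k₂)) :=
  ⟨QMalliavin.inner_eq_of_isDivergence (QMalliavin.isDivergence_divergence u) k₁ k₂,
    fun _ hM => QMalliavin.inner_eq_of_isDivergence hM k₁ k₂⟩
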